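/- **Oracle inequality.** Let $n,p,K\ge 1$ and observe $Y=f+\Sigma_0^{1/2}\varepsilon$ in $\mathbb R^n$, with $f\in\mathbb R^n$, $\varepsilon\sim N(0,I_n)$ and $\Sigma_0=\mathrm{diag}(\sigma_{0,1}^2,\dots,\sigma_{0,n}^2)$. The approximate model used by the statistician is $y=\Psi^{T}\theta+\Sigma^{1/2}\varepsilon$, with a $p\times n$ matrix $\Psi$, $\theta\in\mathbb R^p$ and $\Sigma=\mathrm{diag}(\sigma_1^2,\dots,\sigma_n^2)$, $\sigma_i>0$. For $k=1,\dots,K$ let $w_{k,i}\in[0,1]$ be weights, $\mathbf W_k=\mathrm{diag}(w_{k,i}/\sigma_i^2)_{i\le n}$ and $B_k=\Psi\mathbf W_k\Psi^{T}$, where $\det B_k>0$. Let $D_k=B_k^{-1}\Psi\mathbf W_k$, and let $\tilde\theta_k=D_kY$ be the quasi-maximum likelihood estimator, i.e. the maximizer over $\theta\in\mathbb R^p$ of $L(\mathbf W_k,\theta)=-\frac12(Y-\Psi^T\theta)^T\mathbf W_k(Y-\Psi^T\theta)$. *Adaptive estimate.* For $l<m$ let $T_{lm}=2\{L(\mathbf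 W_l,\tilde\theta_l)-L(\mathbf W_l,\tilde\theta_m)\}=(\tilde\theta_l-\tilde\theta_m)^TB_l(\tilde\theta_l-\tilde\theta_m)$. Given critical values $z_1,\dots,z_{K-1}\ge 0$, let $\hat k=\max\{k\le K: T_{lm}\le z_l \text{ for all } 1\le l<m\le k\}$, $\hat\theta=\tilde\theta_{\hat k}$ and $\hat\theta_k=\tilde\theta_{\min\{k,\hat k\}}$. Let $r>0$ and $\alpha\in(0,1]$, and assume that the critical values satisfy the propagation conditions $$E_{0,\Sigma}\big|(\tilde\theta_k-\hat\theta_k)^TB_k(\tilde\theta_k-\hat\theta_k)\big|^r\le\alpha\,E|\chi^2_p|^r,\qquad k=2,\dots,K,$$ where $E_{0,\Sigma}$ is the expectation when the data have the law $N(0,\Sigma)$, and $\chi^2_p$ is a chi-squared variable with $p$ degrees of freedom. Put $z_K:=0$ (any value $\ge0$ will do). *Modeling bias.* Let $\boldsymbol\Sigma_k$ be the $pk\times pk$ matrix with $p\times p$ blocks $D_l\Sigma D_m^T$, $l,m\le k$ (the joint covariance matrix of $\tilde\theta_1,\dots,\tilde\theta_k$ in the approximate model), and assume that $\boldsymbol\Sigma_K$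 is positive definite. For a fixed $\theta\in\mathbb R^p$ let $b(k)\in\mathbb R^{pk}$ be the vector with blocks $D_lf-\theta$, $l\le k$, and let $\Delta(k)=b(k)^T\boldsymbol\Sigma_k^{-1}b(k)$. *Assumptions.* - (A1) $\mathrm{rank}\,\Psi=p$. - (A2) $\#\{i:w_{1,i}>0\}\ge p$. - (A3) $w_{1,i}\le w_{2,i}\le\dots\le w_{K,i}$ for all $i$. - (A4) $\delta\in[0,1)$ satisfies $1-\delta\le\sigma_{0,i}^2/\sigma_i^2\le1+\delta$ for all $i$. - (A5) There are constants $1<u_0\le u$ with $u_0I_p\preceq B_{k-1}^{-1/2}B_kB_{k-1}^{-1/2}\preceq uI_p$ for $2\le k\le K$, where $\preceq$ is the Löwner order. *Conclusion.* Let $\Delta$ satisfy $\Delta(1)\le\Delta$, and let $k^*=\max\{k\le K:\Delta(k)\le\Delta\}$ be the oracle index. Then, with $E$ the expectation under the true law of $Y$, $$E\big|(\tilde\theta_{k^*}-\hat\theta)^TB_{k^*}(\tilde\theta_{k^*}-\hat\theta)\big|^{r/2}\le z_{k^*}^{r/2}+(\alpha E|\chi^2_p|^r)^{1/2}(1+\delta)^{pk^*/4}(1-\delta)^{-3pk^*/4}\exp\Big\{\varphi(\delta)\frac{\Delta}{2(1-\delta)}\Big\},$$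 where $\varphi(\delta)=1$ for homogeneous errors (all $\sigma_{0,i}$ equal and all $\sigma_i$ equal) and $\varphi(\delta)=\frac{2(1+\delta)}{(1-\delta)^2}-1$ otherwise. -/

import Mathlib

open MeasureTheory ProbabilityTheory Matrix
open scoped ENNReal Kronecker

noncomputable section

/-- The law of `m + Σ^{1/2} ε` for `ε ∼ N(0, I_n)` and `Σ = diag(σ_1², …, σ_n²)`,
i.e. the Gaussian law `N(m, Σ)` on `ℝⁿ`. -/
def obsLaw {n : ℕ} (m σ : Fin n → ℝ) : Measure (Fin n → ℝ) :=
  (Measure.pi fun _ : Fin n => gaussianReal 0 1).map fun ε i => m i + σ i * ε i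

/-- `E |χ²_p|^r`: the `r`-th moment of the squared Euclidean norm of a standard normal
vector in `ℝᵖ`. -/
def chiSqMoment (p : ℕ) (r : ℝ) : ℝ :=
  ∫ ξ : Fin p → ℝ, |∑ j, ξ j ^ 2| ^ r ∂(Measure.pi fun _ : Fin p => gaussianReal 0 1)

/-- The diagonal matrix `W_k = diag(w_{k,1} / σ_1², …, w_{k,n} / σ_n²)`. -/
def weightMat {n : ℕ} (σ : Fin n → ℝ) (w : ℕ → Fin n → ℝ) (k : ℕ) :
    Matrix (Fin n) (Fin n) ℝ :=
  Matrix.diagonal fun i => w k i / σ i ^ 2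

/-- `B_k = Ψ W_k Ψᵀ`. -/
def infoMat {n p : ℕ} (Ψ : Matrix (Fin p) (Fin n) ℝ) (σ : Fin n → ℝ) (w : ℕ → Fin n → ℝ)
    (k : ℕ) : Matrix (Fin p) (Fin p) ℝ :=
  Ψ * weightMat σ w k * Ψᵀ

/-- The local quasi log-likelihood `L(W_k, θ)` of the data `y`, without the additive terms that do
not depend on `θ`. -/
def logLik {n p : ℕ} (Ψ : Matrix (Fin p) (Fin n) ℝ) (σ : Fin n → ℝ) (w : ℕ → Fin n → ℝ)
    (y : Fin n → ℝ) (k : ℕ) (θ : Fin p → ℝ) : ℝ :=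
  -(1 / 2) * ((y - Ψᵀ *ᵥ θ) ⬝ᵥ (weightMat σ w k *ᵥ (y - Ψᵀ *ᵥ θ)))

/-- `D_k = B_k⁻¹ Ψ W_k`. -/
def estMat {n p : ℕ} (Ψ : Matrix (Fin p) (Fin n) ℝ) (σ : Fin n → ℝ) (w : ℕ → Fin n → ℝ)
    (k : ℕ) : Matrix (Fin p) (Fin n) ℝ :=
  (infoMat Ψ σ w k)⁻¹ * Ψ * weightMat σ w k

/-- The quasi maximum likelihood estimator `θ̃_k = B_k⁻¹ Ψ W_k y`. For `B_k` positive definite it is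
the unique maximizer of the local log-likelihood, see `qmle_eq_argmax`. -/
def qmle {n p : ℕ} (Ψ : Matrix (Fin p) (Fin n) ℝ) (σ : Fin n → ℝ) (w : ℕ → Fin n → ℝ)
    (y : Fin n → ℝ) (k : ℕ) : Fin p → ℝ :=
  estMat Ψ σ w k *ᵥ y

/-- The squared `B_k`-norm `(a - b)ᵀ B_k (a - b)`. -/
def quadDist {n p : ℕ} (Ψ : Matrix (Fin p) (Fin n) ℝ) (σ : Fin n → ℝ) (w : ℕ → Fin n → ℝ)
    (k : ℕ) (a b : Fin p → ℝ) : ℝ :=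
  (a - b) ⬝ᵥ (infoMat Ψ σ w k *ᵥ (a - b))

/-- The fitted log-likelihood statistic `T_{lm} = 2 (L(W_l, θ̃_l) - L(W_l, θ̃_m))`. -/
def fllStat {n p : ℕ} (Ψ : Matrix (Fin p) (Fin n) ℝ) (σ : Fin n → ℝ) (w : ℕ → Fin n → ℝ)
    (y : Fin n → ℝ) (l m : ℕ) : ℝ :=
  2 * (logLik Ψ σ w y l (qmle Ψ σ w y l) - logLik Ψ σ w y l (qmle Ψ σ w y m))

/-- The fitted log-likelihood is a quadratic form. -/
theorem two_mul_logLik_sub {n p : ℕ} (Ψ : Matrix (Fin p) (Fin n) ℝ) (σ : Fin n → ℝ)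
    (w : ℕ → Fin n → ℝ) (y : Fin n → ℝ) (k : ℕ) (hB : IsUnit (infoMat Ψ σ w k).det)
    (θ : Fin p → ℝ) :
    2 * (logLik Ψ σ w y k (qmle Ψ σ w y k) - logLik Ψ σ w y k θ) =
      quadDist Ψ σ w k (qmle Ψ σ w y k) θ := by
  have hW : ∀ u v : Fin n → ℝ,
      u ⬝ᵥ (weightMat σ w k *ᵥ v) = v ⬝ᵥ (weightMat σ w k *ᵥ u) := by
    intro u v
    simp only [weightMat, Matrix.mulVec_diagonal, dotProduct]
    exact Finset.sum_congr rfl fun i _ => by ring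
  have hT : ∀ (d : Fin p → ℝ) (v : Fin n → ℝ), (Ψᵀ *ᵥ d) ⬝ᵥ v = d ⬝ᵥ (Ψ *ᵥ v) := by
    intro d v
    rw [Matrix.mulVec_transpose, Matrix.dotProduct_mulVec]
  have hN : infoMat Ψ σ w k *ᵥ qmle Ψ σ w y k = Ψ *ᵥ (weightMat σ w k *ᵥ y) := by
    rw [qmle, estMat, Matrix.mulVec_mulVec, Matrix.mul_assoc, ← Matrix.mul_assoc,
      Matrix.mul_nonsing_inv _ hB, Matrix.one_mul, Matrix.mulVec_mulVec]
  have hB' : ∀ d : Fin p → ℝ,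
      Ψ *ᵥ (weightMat σ w k *ᵥ (Ψᵀ *ᵥ d)) = infoMat Ψ σ w k *ᵥ d := by
    intro d
    rw [Matrix.mulVec_mulVec, Matrix.mulVec_mulVec, infoMat, Matrix.mul_assoc]
  set t := qmle Ψ σ w y k with ht
  have he : Ψ *ᵥ (weightMat σ w k *ᵥ (y - Ψᵀ *ᵥ t)) = 0 := by
    rw [Matrix.mulVec_sub, Matrix.mulVec_sub, hB', hN, sub_self]
  have hs : y - Ψᵀ *ᵥ θ = (y - Ψᵀ *ᵥ t) + Ψᵀ *ᵥ (t - θ) := by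
    rw [Matrix.mulVec_sub]; abel
  rw [logLik, logLik, hs, quadDist]
  generalize y - Ψᵀ *ᵥ t = e at he
  rw [Matrix.mulVec_add, dotProduct_add, add_dotProduct, add_dotProduct,
    hW e (Ψᵀ *ᵥ (t - θ)), hT, hT, he, hB', dotProduct_zero]
  ring

/-- For `B_k` positive definite, `qmle` is the unique maximizer of the local log-likelihood. -/
theorem qmle_eq_argmax {n p : ℕ} (Ψ : Matrix (Fin p) (Fin n) ℝ) (σ : Fin n → ℝ)
    (w : ℕ → Fin n → ℝ) (y : Fin n → ℝ) (k : ℕ) (hB : (infoMat Ψ σ w k).PosDef)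
    (θ : Fin p → ℝ) :
    IsMaxOn (logLik Ψ σ w y k) Set.univ θ ↔ θ = qmle Ψ σ w y k := by
  have hu : IsUnit (infoMat Ψ σ w k).det := isUnit_iff_ne_zero.2 hB.det_pos.ne'
  have key := two_mul_logLik_sub Ψ σ w y k hu
  constructor
  · intro h
    by_contra hne
    have h1 : logLik Ψ σ w y k (qmle Ψ σ w y k) ≤ logLik Ψ σ w y k θ :=
      h (Set.mem_univ _)
    have h2 := hB.dotProduct_mulVec_pos (sub_ne_zero.2 (Ne.symm hne))
    have h3 := key θ
    simp only [star_trivial] at h2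
    rw [quadDist] at h3
    linarith
  · rintro rfl θ' -
    have h2 := hB.posSemidef.dotProduct_mulVec_nonneg (qmle Ψ σ w y k - θ')
    have h3 := key θ'
    simp only [star_trivial] at h2
    rw [quadDist] at h3
    show logLik Ψ σ w y k θ' ≤ logLik Ψ σ w y k (qmle Ψ σ w y k)
    linarith

open Classical in
/-- The adaptive index `k̂ = max {k ≤ K : T_{lm} ≤ z_l for all 1 ≤ l < m ≤ k}`; the index `1` is
always accepted. -/
def adaptIndex {n p : ℕ} (Ψ : Matrix (Fin p) (Fin n) ℝ) (σ : Fin n → ℝ) (w : ℕ → Fin n → ℝ)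
    (K : ℕ) (z : ℕ → ℝ) (y : Fin n → ℝ) : ℕ :=
  Nat.findGreatest
    (fun k => ∀ l m : ℕ, 1 ≤ l → l < m → m ≤ k → fllStat Ψ σ w y l m ≤ z l) K

/-- The adaptive estimate `θ̂ = θ̃_{k̂}`. -/
def adaptEst {n p : ℕ} (Ψ : Matrix (Fin p) (Fin n) ℝ) (σ : Fin n → ℝ) (w : ℕ → Fin n → ℝ)
    (K : ℕ) (z : ℕ → ℝ) (y : Fin n → ℝ) : Fin p → ℝ :=
  qmle Ψ σ w y (adaptIndex Ψ σ w K z y)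

/-- The last accepted estimate `θ̂_k = θ̃_{min(k, k̂)}` after the first `k` steps. -/
def lastAccepted {n p : ℕ} (Ψ : Matrix (Fin p) (Fin n) ℝ) (σ : Fin n → ℝ) (w : ℕ → Fin n → ℝ)
    (K : ℕ) (z : ℕ → ℝ) (k : ℕ) (y : Fin n → ℝ) : Fin p → ℝ :=
  qmle Ψ σ w y (min k (adaptIndex Ψ σ w K z y))

/-- Propagation conditions on the critical values:
`E_{0,Σ} |(θ̃_k - θ̂_k)ᵀ B_k (θ̃_k - θ̂_k)|^r ≤ α E|χ²_p|^r` for `k = 2, …, K`. -/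
def PropagationConditions {n p : ℕ} (Ψ : Matrix (Fin p) (Fin n) ℝ) (σ : Fin n → ℝ)
    (w : ℕ → Fin n → ℝ) (K : ℕ) (z : ℕ → ℝ) (r α : ℝ) : Prop :=
  ∀ k : ℕ, 2 ≤ k → k ≤ K →
    ∫⁻ y, ENNReal.ofReal
        (|quadDist Ψ σ w k (qmle Ψ σ w y k) (lastAccepted Ψ σ w K z k y)| ^ r) ∂(obsLaw 0 σ)
      ≤ ENNReal.ofReal (α * chiSqMoment p r)

open scoped MatrixOrder in
/-- `u₀ I ⪯ B_{k-1}^{-1/2} B_k B_{k-1}^{-1/2} ⪯ u I` for `2 ≤ k ≤ K`, with `1 < u₀ ≤ u`; here `⪯`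
is the Löwner order. -/
def GeometricGrowth {n p : ℕ} (Ψ : Matrix (Fin p) (Fin n) ℝ) (σ : Fin n → ℝ)
    (w : ℕ → Fin n → ℝ) (K : ℕ) : Prop :=
  ∃ u₀ u : ℝ, 1 < u₀ ∧ u₀ ≤ u ∧ ∀ k : ℕ, 2 ≤ k → k ≤ K →
    u₀ • (1 : Matrix (Fin p) (Fin p) ℝ) ≤
        (CFC.sqrt (infoMat Ψ σ w (k - 1)))⁻¹ * infoMat Ψ σ w k *
          (CFC.sqrt (infoMat Ψ σ w (k - 1)))⁻¹ ∧
      (CFC.sqrt (infoMat Ψ σ w (k - 1)))⁻¹ * infoMat Ψ σ w k *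
          (CFC.sqrt (infoMat Ψ σ w (k - 1)))⁻¹ ≤ u • (1 : Matrix (Fin p) (Fin p) ℝ)

/-- The block diagonal `pk × nk` matrix `D_1 ⊕ ⋯ ⊕ D_k`. The block with index `l : Fin k` belongs to
the window `l + 1`. -/
def blockEstMat {n p : ℕ} (Ψ : Matrix (Fin p) (Fin n) ℝ) (σ : Fin n → ℝ) (w : ℕ → Fin n → ℝ)
    (k : ℕ) : Matrix (Fin k × Fin p) (Fin k × Fin n) ℝ :=
  Matrix.of fun a b => if a.1 = b.1 then estMat Ψ σ w (a.1 + 1) a.2 b.2 else 0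

/-- The joint covariance matrix `(D_1 ⊕ ⋯ ⊕ D_k) (J_k ⊗ Σ) (D_1 ⊕ ⋯ ⊕ D_k)ᵀ` of
`θ̃_1, …, θ̃_k` under `N(·, Σ)`, where `J_k` is the all-ones matrix. -/
def jointCov {n p : ℕ} (Ψ : Matrix (Fin p) (Fin n) ℝ) (σ : Fin n → ℝ) (w : ℕ → Fin n → ℝ)
    (k : ℕ) : Matrix (Fin k × Fin p) (Fin k × Fin p) ℝ :=
  blockEstMat Ψ σ w k *
    ((Matrix.of fun _ _ => 1 : Matrix (Fin k) (Fin k) ℝ) ⊗ₖ Matrix.diagonal fun i => σ i ^ 2) *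
    (blockEstMat Ψ σ w k)ᵀ

/-- The stacked bias vector `b(k) = (θ*_1 - θ, …, θ*_k - θ)` with
`θ*_l = E_{f,Σ₀} θ̃_l = B_l⁻¹ Ψ W_l f`. -/
def biasVec {n p : ℕ} (Ψ : Matrix (Fin p) (Fin n) ℝ) (σ : Fin n → ℝ) (w : ℕ → Fin n → ℝ)
    (f : Fin n → ℝ) (θ : Fin p → ℝ) (k : ℕ) : Fin k × Fin p → ℝ :=
  fun a => (estMat Ψ σ w (a.1 + 1) *ᵥ f - θ) a.2

/-- The modeling bias `Δ(k) = b(k)ᵀ Σ_k⁻¹ b(k)`, where `Σ_k` is the joint covariance matrix. -/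
def modelBias {n p : ℕ} (Ψ : Matrix (Fin p) (Fin n) ℝ) (σ : Fin n → ℝ) (w : ℕ → Fin n → ℝ)
    (f : Fin n → ℝ) (θ : Fin p → ℝ) (k : ℕ) : ℝ :=
  biasVec Ψ σ w f θ k ⬝ᵥ ((jointCov Ψ σ w k)⁻¹ *ᵥ biasVec Ψ σ w f θ k)

open Classical in
/-- The oracle index `k* = max {k ≤ K : Δ(k) ≤ Δ}`. -/
def oracleIndex {n p : ℕ} (Ψ : Matrix (Fin p) (Fin n) ℝ) (σ : Fin n → ℝ) (w : ℕ → Fin n → ℝ)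
    (f : Fin n → ℝ) (θ : Fin p → ℝ) (K : ℕ) (Δ : ℝ) : ℕ :=
  Nat.findGreatest (fun k => modelBias Ψ σ w f θ k ≤ Δ) K

open Classical in
/-- `φ(δ)` equals `1` for homogeneous errors (all `σ_{0,i}` equal and all `σ_i` equal) and
`2 (1 + δ) / (1 - δ)² - 1` otherwise. -/
def noiseFactor {n : ℕ} (σ₀ σ : Fin n → ℝ) (δ : ℝ) : ℝ :=
  if (∀ i j, σ₀ i = σ₀ j) ∧ (∀ i j, σ i = σ j) then 1
  else 2 * (1 + δ) / (1 - δ) ^ 2 - 1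

end

/-! If `k̂ > k*`, window `k*` was accepted against `k̂`, so the loss equals `T_{k* k̂}` and is at
most `z_{k*}`. If `k̂ ≤ k*`, then `θ̂` is the last accepted estimate `θ̂_{k*}`. Hence the risk is at
most `z_{k*}^{r/2}` plus the risk of `θ̃_{k*} - θ̂_{k*}` (`quadDist_adaptEst_rpow_le`).

The latter loss is a function of `θ̃_1, …, θ̃_{k*}` alone and is unchanged when all of them are
shifted by one `θ` (`acceptedLoss_congr`). The true mean of these estimates may therefore be taken
to be `b(k*)` and the model mean `0`. One linear map `R` turns their covariance in the model into
the identity and their true covariance into a diagonal matrix with entries in `[1 - δ, 1 + δ]`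
(`exists_simultaneous_diagonalization`, `diagonalized_variance_bounds`). Both laws become products
of one-dimensional Gaussians, and `‖R b(k*)‖² = Δ(k*)`.

By Cauchy–Schwarz the true risk is at most the root of the second moment of the loss in the model,
which the propagation condition bounds, times the root of the second moment of the likelihood ratio
(`lintegral_pi_gaussian_le`). The latter is an explicit product over `p k*` coordinates
(`lintegral_gaussianRatio_sq`, `sqrt_prod_ratio_moment_le`). -/

section

open scoped NNReal

/-! ### Likelihood ratios of Gaussian product laws and their second moments. -/

/-- A product of measures with densities has the product density. -/
theorem pi_withDensity_eq {ι : Type*} [Fintype ι] {X : ι → Type*}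
    [∀ i, MeasurableSpace (X i)] (μ : ∀ i, Measure (X i)) [∀ i, IsProbabilityMeasure (μ i)]
    (ρ : ∀ i, X i → ℝ≥0∞) (hρ : ∀ i, Measurable (ρ i))
    [∀ i, SigmaFinite ((μ i).withDensity (ρ i))] :
    Measure.pi (fun i => (μ i).withDensity (ρ i)) =
      (Measure.pi μ).withDensity fun x => ∏ i, ρ i (x i) := by
  refine Measure.pi_eq fun s hs => ?_
  rw [withDensity_apply _ (MeasurableSet.univ_pi hs),
    ← lintegral_indicator (MeasurableSet.univ_pi hs)]
  have h1 : (fun x : ∀ i, X i => (Set.univ.pi s).indicator (fun x => ∏ i, ρ i (x i)) x) =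
      fun x => ∏ i, (s i).indicator (ρ i) (x i) := by
    classical
    funext x
    by_cases hx : x ∈ Set.univ.pi s
    · rw [Set.indicator_of_mem hx]
      exact Finset.prod_congr rfl fun i _ =>
        (Set.indicator_of_mem (hx i (Set.mem_univ i)) _).symm
    · rw [Set.indicator_of_notMem hx]
      simp only [Set.mem_univ_pi, not_forall] at hx
      obtain ⟨i, hi⟩ := hx
      exact (Finset.prod_eq_zero (Finset.mem_univ i) (Set.indicator_of_notMem hi _)).symm
  rw [h1, lintegral_prod_eq_prod_lintegral_of_indepFun Finset.univ
    (fun i (x : ∀ i, X i) => (s i).indicator (ρ i) (x i))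
    (iIndepFun_pi fun i => ((hρ i).indicator (hs i)).aemeasurable)
    fun i => ((hρ i).indicator (hs i)).comp (measurable_pi_apply i)]
  refine Finset.prod_congr rfl fun i _ => ?_
  rw [(measurePreserving_eval μ i).lintegral_comp ((hρ i).indicator (hs i)),
    lintegral_indicator (hs i), withDensity_apply _ (hs i)]

/-- The second moment of the product density is the product of the second moments. -/
theorem lintegral_prod_sq {ι : Type*} [Fintype ι] {X : ι → Type*}
    [∀ i, MeasurableSpace (X i)] (μ : ∀ i, Measure (X i)) [∀ i, IsProbabilityMeasure (μ i)]
    (ρ : ∀ i, X i → ℝ≥0∞) (hρ : ∀ i, Measurable (ρ i)) :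
    ∫⁻ x, (∏ i, ρ i (x i)) ^ (2 : ℝ) ∂(Measure.pi μ) = ∏ i, ∫⁻ t, ρ i t ^ (2 : ℝ) ∂(μ i) := by
  simp_rw [← ENNReal.prod_rpow_of_nonneg (zero_le_two (α := ℝ))]
  rw [lintegral_prod_eq_prod_lintegral_of_indepFun Finset.univ
    (fun i (x : ∀ i, X i) => ρ i (x i) ^ (2 : ℝ))
    (iIndepFun_pi (X := fun i t => ρ i t ^ (2 : ℝ)) fun i => ((hρ i).pow_const _).aemeasurable)
    fun i => ((hρ i).pow_const _).comp (measurable_pi_apply i)]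
  exact Finset.prod_congr rfl fun i _ =>
    (measurePreserving_eval μ i).lintegral_comp ((hρ i).pow_const _)

/-- The likelihood ratio of `N(b, v)` with respect to `N(0, 1)`. -/
noncomputable def gaussianRatio (b : ℝ) (v : ℝ≥0) (x : ℝ) : ℝ≥0∞ :=
  ENNReal.ofReal (gaussianPDFReal b v x / gaussianPDFReal 0 1 x)

theorem measurable_gaussianRatio (b : ℝ) (v : ℝ≥0) : Measurable (gaussianRatio b v) :=
  ((measurable_gaussianPDFReal b v).div (measurable_gaussianPDFReal 0 1)).ennreal_ofReal

theorem gaussianReal_withDensity_ratio (b : ℝ) {v : ℝ≥0} (hv : v ≠ 0) :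
    (gaussianReal 0 1).withDensity (gaussianRatio b v) = gaussianReal b v := by
  rw [gaussianReal_of_var_ne_zero _ one_ne_zero, gaussianReal_of_var_ne_zero _ hv,
    ← withDensity_mul _ (measurable_gaussianPDF 0 1) (measurable_gaussianRatio b v)]
  congr 1
  funext x
  have h := gaussianPDFReal_pos 0 1 x one_ne_zero
  rw [Pi.mul_apply, gaussianPDF, gaussianPDF, gaussianRatio, ← ENNReal.ofReal_mul h.le,
    mul_div_cancel₀ _ h.ne']

/-- The second moment of the likelihood ratio of two one-dimensional Gaussian laws. -/
theorem lintegral_gaussianRatio_sq (b : ℝ) {v : ℝ≥0} (hv : v ≠ 0) (hv2 : (v : ℝ) < 2) :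
    ∫⁻ x, gaussianRatio b v x ^ (2 : ℝ) ∂(gaussianReal 0 1) =
      ENNReal.ofReal ((√(v * (2 - v)))⁻¹ * Real.exp (b ^ 2 / (2 - v))) := by
  have hv0 : (0 : ℝ) < v := by exact_mod_cast pos_iff_ne_zero.2 hv
  have h2 : (0 : ℝ) < 2 - v := by linarith
  -- Completing the square, the squared `N(b, v)` density over the `N(0, 1)` density is a multiple
  -- of the density of `N(2b/(2 - v), v/(2 - v))`. The condition `v < 2` makes this variance
  -- positive.
  set τ : ℝ≥0 := .mk (v / (2 - v)) (div_pos hv0 h2).le with hτ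
  have hτv : (τ : ℝ) = v / (2 - v) := rfl
  have hτ0 : τ ≠ 0 := by
    intro h
    have : (τ : ℝ) = 0 := by rw [h]; rfl
    rw [hτv] at this
    exact (div_pos hv0 h2).ne' this
  rw [gaussianReal_of_var_ne_zero _ one_ne_zero,
    lintegral_withDensity_eq_lintegral_mul _ (measurable_gaussianPDF 0 1)
      ((measurable_gaussianRatio b v).pow_const _)]
  have key : ∀ x, (gaussianPDF 0 1 * fun a => gaussianRatio b v a ^ (2 : ℝ)) x =
      ENNReal.ofReal ((√(v * (2 - v)))⁻¹ * Real.exp (b ^ 2 / (2 - v))) *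
        gaussianPDF (2 * b / (2 - v)) τ x := by
    intro x
    have h := gaussianPDFReal_pos 0 1 x one_ne_zero
    rw [Pi.mul_apply, gaussianPDF, gaussianPDF, gaussianRatio,
      ENNReal.ofReal_rpow_of_nonneg (div_nonneg (gaussianPDFReal_nonneg _ _ _) h.le) zero_le_two,
      ← ENNReal.ofReal_mul h.le, ← ENNReal.ofReal_mul (by positivity)]
    congr 1
    rw [Real.rpow_two, div_pow]
    have e1 : gaussianPDFReal 0 1 x * (gaussianPDFReal b v x ^ 2 / gaussianPDFReal 0 1 x ^ 2) =
        gaussianPDFReal b v x ^ 2 / gaussianPDFReal 0 1 x := by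
      field_simp
    rw [e1, div_eq_iff h.ne']
    simp only [gaussianPDFReal, hτv, NNReal.coe_one, mul_one, sub_zero]
    have hpi := Real.pi_pos
    have e2 : √(2 * Real.pi * (v / (2 - v))) = √(2 * Real.pi) * √v / √(2 - v) := by
      rw [Real.sqrt_mul (by positivity), Real.sqrt_div hv0.le, mul_div_assoc]
    have e3 : √(2 * Real.pi * v) = √(2 * Real.pi) * √v := Real.sqrt_mul (by positivity) _
    have e4 : √(v * (2 - v)) = √v * √(2 - v) := Real.sqrt_mul hv0.le _
    have e5 : Real.exp (-(x - b) ^ 2 / (2 * v)) ^ 2 =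
        Real.exp (b ^ 2 / (2 - v)) *
          Real.exp (-(x - 2 * b / (2 - v)) ^ 2 / (2 * (v / (2 - v)))) *
          Real.exp (-x ^ 2 / 2) := by
      rw [← Real.exp_nat_mul, ← Real.exp_add, ← Real.exp_add]
      congr 1
      push_cast
      field_simp
      ring
    rw [e2, e3, e4, mul_pow, e5]
    have s1 : 0 < √(2 * Real.pi) := by positivity
    have s2 : 0 < √(v : ℝ) := Real.sqrt_pos.2 hv0
    have s3 : 0 < √(2 - (v : ℝ)) := Real.sqrt_pos.2 h2
    field_simp
  rw [lintegral_congr key, lintegral_const_mul _ (measurable_gaussianPDF _ _),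
    lintegral_gaussianPDF_eq_one _ hτ0, mul_one]

/-- Change of measure between Gaussian product laws by the Cauchy–Schwarz inequality. -/
theorem lintegral_pi_gaussian_le {ι : Type*} [Fintype ι] (b : ι → ℝ) (v : ι → ℝ≥0)
    (hv : ∀ j, v j ≠ 0) (hv2 : ∀ j, (v j : ℝ) < 2) {G : (ι → ℝ) → ℝ≥0∞} (hG : Measurable G) :
    ∫⁻ x, G x ∂(Measure.pi fun j => gaussianReal (b j) (v j)) ≤
      (∫⁻ x, G x ^ (2 : ℝ) ∂(Measure.pi fun _ => gaussianReal 0 1)) ^ (1 / 2 : ℝ) *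
        (ENNReal.ofReal (∏ j, ((√(v j * (2 - v j)))⁻¹ * Real.exp (b j ^ 2 / (2 - v j))))) ^
          (1 / 2 : ℝ) := by
  have : ∀ j, IsProbabilityMeasure ((gaussianReal 0 1).withDensity (gaussianRatio (b j) (v j))) :=
    fun j => by rw [gaussianReal_withDensity_ratio _ (hv j)]; infer_instance
  have hm : Measurable fun x : ι → ℝ => ∏ j, gaussianRatio (b j) (v j) (x j) :=
    Finset.measurable_prod _ fun j _ =>
      (measurable_gaussianRatio (b j) (v j)).comp (measurable_pi_apply j)
  have e : (Measure.pi fun j => gaussianReal (b j) (v j)) =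
      (Measure.pi fun _ => gaussianReal 0 1).withDensity
        fun x => ∏ j, gaussianRatio (b j) (v j) (x j) := by
    rw [← pi_withDensity_eq (fun _ : ι => gaussianReal 0 1)
      (fun j => gaussianRatio (b j) (v j)) fun j => measurable_gaussianRatio _ _]
    congr 1
    funext j
    rw [gaussianReal_withDensity_ratio _ (hv j)]
  rw [e, lintegral_withDensity_eq_lintegral_mul _ hm hG, mul_comm]
  refine (ENNReal.lintegral_mul_le_Lp_mul_Lq _ Real.HolderConjugate.two_two hG.aemeasurable
    hm.aemeasurable).trans (le_of_eq ?_)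
  rw [lintegral_prod_sq (fun _ : ι => gaussianReal 0 1) (fun j => gaussianRatio (b j) (v j))
    fun j => measurable_gaussianRatio _ _, ENNReal.ofReal_prod_of_nonneg]
  · congr 2
    exact Finset.prod_congr rfl fun j _ => lintegral_gaussianRatio_sq _ (hv j) (hv2 j)
  · intros; positivity

/-! ### Gaussian laws under linear maps. -/

theorem obsLaw_eq_pi {n : ℕ} (m σ : Fin n → ℝ) :
    obsLaw m σ = Measure.pi fun i => gaussianReal (m i) (.mk (σ i ^ 2) (sq_nonneg _)) := by
  have h : ∀ i, (gaussianReal 0 1).map (fun t => m i + σ i * t) =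
      gaussianReal (m i) (.mk (σ i ^ 2) (sq_nonneg _)) := by
    intro i
    have : (fun t => m i + σ i * t) = (fun t => m i + t) ∘ fun t => σ i * t := rfl
    rw [this, ← Measure.map_map (by fun_prop) (by fun_prop), gaussianReal_map_const_mul,
      gaussianReal_map_const_add]
    simp
  have := fun i => Measure.isProbabilityMeasure_map
    (μ := gaussianReal 0 1) (f := fun t => m i + σ i * t) (by fun_prop)
  rw [obsLaw, Measure.pi_map_pi (μ := fun _ : Fin n => gaussianReal 0 1)
    (f := fun i t => m i + σ i * t) (fun i => by fun_prop)]
  congr 1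
  funext i
  exact h i

instance {n : ℕ} (m σ : Fin n → ℝ) : IsProbabilityMeasure (obsLaw m σ) := by
  rw [obsLaw_eq_pi]; infer_instance

theorem charFunDual_pi_gaussianReal {ι : Type*} [Fintype ι] [DecidableEq ι] (m : ι → ℝ)
    (v : ι → ℝ≥0) (L : StrongDual ℝ (ι → ℝ)) :
    charFunDual (Measure.pi fun i => gaussianReal (m i) (v i)) L =
      Complex.exp (((∑ i, L (Pi.single i 1) * m i : ℝ) : ℂ) * Complex.I -
        ((∑ i, L (Pi.single i 1) ^ 2 * v i : ℝ) : ℂ) / 2) := by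
  rw [charFunDual_pi]
  have h : ∀ i, charFunDual (gaussianReal (m i) (v i)) (L.comp (.single ℝ (fun _ => ℝ) i)) =
      Complex.exp (((L (Pi.single i 1) * m i : ℝ) : ℂ) * Complex.I -
        ((L (Pi.single i 1) ^ 2 * v i : ℝ) : ℂ) / 2) := by
    intro i
    rw [charFunDual_eq_charFun_map_one, gaussianReal_map_continuousLinearMap, charFun_gaussianReal]
    have hs : L (Pi.single i (m i)) = L (Pi.single i 1) * m i := by
      have : (Pi.single i (m i) : ι → ℝ) = m i • Pi.single i 1 := by
        rw [← Pi.single_smul, smul_eq_mul, mul_one]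
      rw [this, map_smul, smul_eq_mul, mul_comm]
    congr 1
    simp [hs, max_eq_left (sq_nonneg _)]
  rw [Finset.prod_congr rfl fun i _ => h i, ← Complex.exp_sum]
  congr 1
  push_cast
  rw [Finset.sum_sub_distrib, Finset.sum_mul, Finset.sum_div]

/-- A linear map that diagonalizes the covariance maps `N(m, Σ)` to a product law. -/
theorem obsLaw_map_mulVec {n : ℕ} {ι : Type*} [Fintype ι] [DecidableEq ι] (m σ : Fin n → ℝ)
    (Q : Matrix ι (Fin n) ℝ) (v : ι → ℝ≥0)
    (hQ : Q * diagonal (fun i => σ i ^ 2) * Qᵀ = diagonal fun j => (v j : ℝ)) :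
    (obsLaw m σ).map (fun y => Q *ᵥ y) =
      Measure.pi fun j => gaussianReal ((Q *ᵥ m) j) (v j) := by
  have e : (fun y => Q *ᵥ y) = (Q.mulVecLin.toContinuousLinearMap : (Fin n → ℝ) → ι → ℝ) := rfl
  rw [obsLaw_eq_pi, e]
  have := Measure.isProbabilityMeasure_map
    (μ := Measure.pi fun i => gaussianReal (m i) (.mk (σ i ^ 2) (sq_nonneg _)))
    (f := Q.mulVecLin.toContinuousLinearMap) (by fun_prop)
  refine Measure.ext_of_charFunDual (funext fun L => ?_)
  rw [charFunDual_map, charFunDual_pi_gaussianReal, charFunDual_pi_gaussianReal]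
  set c : ι → ℝ := fun j => L (Pi.single j 1) with hc
  have hL : ∀ x : ι → ℝ, L x = c ⬝ᵥ x := by
    intro x
    conv_lhs => rw [← Finset.univ_sum_single x, map_sum]
    refine Finset.sum_congr rfl fun j _ => ?_
    have : (Pi.single j (x j) : ι → ℝ) = x j • Pi.single j 1 := by
      rw [← Pi.single_smul, smul_eq_mul, mul_one]
    rw [this, map_smul, smul_eq_mul, mul_comm]
  have hcol : ∀ i, (L.comp Q.mulVecLin.toContinuousLinearMap) (Pi.single i 1) = (c ᵥ* Q) i := by
    intro i
    rw [ContinuousLinearMap.comp_apply, hL]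
    show c ⬝ᵥ (Q *ᵥ Pi.single i 1) = _
    rw [dotProduct_mulVec, dotProduct_single_one]
  have h1 : ∑ i, (c ᵥ* Q) i * m i = ∑ j, c j * (Q *ᵥ m) j :=
    (dotProduct_mulVec c Q m).symm
  -- The quadratic forms of the two sides of `hQ`, evaluated at `c`, are the variances in the two
  -- characteristic functions.
  have h2 : ∑ i, (c ᵥ* Q) i ^ 2 * σ i ^ 2 = ∑ j, c j ^ 2 * v j := by
    have := congrArg (fun M => c ⬝ᵥ (M *ᵥ c)) hQ
    simp only [← mulVec_mulVec] at this
    rw [dotProduct_mulVec, mulVec_transpose] at this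
    simp only [dotProduct, mulVec_diagonal] at this
    rw [Finset.sum_congr rfl fun i _ => show (c ᵥ* Q) i ^ 2 * σ i ^ 2 =
      (c ᵥ* Q) i * (σ i ^ 2 * (c ᵥ* Q) i) by ring, this]
    exact Finset.sum_congr rfl fun j _ => by ring
  simp only [hcol]
  rw [h1]
  congr 3
  exact_mod_cast h2

/-! ### Simultaneous diagonalization of two covariance matrices. -/

/-- A positive definite and a symmetric matrix are diagonalized by one congruence, which maps the
positive definite matrix to the identity. -/
theorem exists_simultaneous_diagonalization {ι : Type*} [Fintype ι] [DecidableEq ι]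
    {S T : Matrix ι ι ℝ} (hS : S.PosDef) (hT : T.IsHermitian) :
    ∃ (R : Matrix ι ι ℝ) (lam : ι → ℝ),
      R * S * Rᵀ = 1 ∧ R * T * Rᵀ = diagonal lam ∧ Rᵀ * R = S⁻¹ := by
  obtain ⟨C, hC⟩ : ∃ C : Matrix ι ι ℝ, S⁻¹ = Cᵀ * C := by
    open scoped MatrixOrder in
    obtain ⟨C, hC⟩ := CStarAlgebra.nonneg_iff_eq_star_mul_self.mp hS.inv.posSemidef.nonneg
    exact ⟨C, by rw [hC, star_eq_conjTranspose, conjTranspose_eq_transpose_of_trivial]⟩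
  have hu : IsUnit S.det := isUnit_iff_ne_zero.2 hS.det_pos.ne'
  have h1 : C * S * Cᵀ = 1 := by
    rw [mul_eq_one_comm, ← Matrix.mul_assoc, ← hC, nonsing_inv_mul _ hu]
  have hH : (C * T * Cᵀ).IsHermitian := by
    rw [IsHermitian, conjTranspose_eq_transpose_of_trivial] at hT ⊢
    rw [transpose_mul, transpose_mul, transpose_transpose, hT, Matrix.mul_assoc]
  set U : Matrix ι ι ℝ := (hH.eigenvectorUnitary : Matrix ι ι ℝ) with hU
  have hUt : star U = Uᵀ := by
    rw [star_eq_conjTranspose, conjTranspose_eq_transpose_of_trivial]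
  have hUU : Uᵀ * U = 1 := by rw [← hUt]; exact Unitary.coe_star_mul_self _
  have hUU' : U * Uᵀ = 1 := by rw [← hUt]; exact Unitary.coe_mul_star_self _
  have hd : Uᵀ * (C * T * Cᵀ) * U = diagonal hH.eigenvalues := by
    have := hH.conjStarAlgAut_star_eigenvectorUnitary
    rw [Unitary.conjStarAlgAut_star_apply] at this
    rw [← hUt]
    exact this
  refine ⟨Uᵀ * C, hH.eigenvalues, ?_, ?_, ?_⟩
  · rw [transpose_mul, transpose_transpose]
    calc Uᵀ * C * S * (Cᵀ * U) = Uᵀ * (C * S * Cᵀ) * U := by simp only [Matrix.mul_assoc]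
      _ = 1 := by rw [h1, Matrix.mul_one, hUU]
  · rw [transpose_mul, transpose_transpose, ← hd]
    simp only [Matrix.mul_assoc]
  · rw [transpose_mul, transpose_transpose, hC]
    calc Cᵀ * U * (Uᵀ * C) = Cᵀ * (U * Uᵀ) * C := by simp only [Matrix.mul_assoc]
      _ = Cᵀ * C := by rw [hUU', Matrix.mul_one]

/-- The entries of a diagonalized covariance are bounded by the ratios of the variances. -/
theorem diagonalized_variance_bounds {n : ℕ} {ι : Type*} [Fintype ι] [DecidableEq ι]
    {σ σ₀ : Fin n → ℝ} (hσ : ∀ i, 0 < σ i) {δ : ℝ}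
    (h : ∀ i, 1 - δ ≤ σ₀ i ^ 2 / σ i ^ 2 ∧ σ₀ i ^ 2 / σ i ^ 2 ≤ 1 + δ)
    {Q : Matrix ι (Fin n) ℝ} {lam : ι → ℝ}
    (h1 : Q * diagonal (fun i => σ i ^ 2) * Qᵀ = 1)
    (h2 : Q * diagonal (fun i => σ₀ i ^ 2) * Qᵀ = diagonal lam) (j : ι) :
    1 - δ ≤ lam j ∧ lam j ≤ 1 + δ := by
  have e : ∀ s : Fin n → ℝ, (Q * diagonal s * Qᵀ) j j = ∑ i, Q j i ^ 2 * s i := by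
    intro s
    rw [Matrix.mul_apply]
    exact Finset.sum_congr rfl fun i _ => by rw [mul_diagonal, transpose_apply]; ring
  have e1 : ∑ i, Q j i ^ 2 * σ i ^ 2 = 1 := by rw [← e, h1, one_apply_eq]
  have e2 : ∑ i, Q j i ^ 2 * σ₀ i ^ 2 = lam j := by rw [← e, h2, diagonal_apply_eq]
  suffices h : (1 - δ) * ∑ i, Q j i ^ 2 * σ i ^ 2 ≤ ∑ i, Q j i ^ 2 * σ₀ i ^ 2 ∧
      ∑ i, Q j i ^ 2 * σ₀ i ^ 2 ≤ (1 + δ) * ∑ i, Q j i ^ 2 * σ i ^ 2 by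
    rwa [e1, e2, mul_one, mul_one] at h
  rw [Finset.mul_sum, Finset.mul_sum]
  constructor
  · refine Finset.sum_le_sum fun i _ => ?_
    have := (le_div_iff₀ (pow_pos (hσ i) 2)).1 (h i).1
    nlinarith [mul_le_mul_of_nonneg_left this (sq_nonneg (Q j i))]
  · refine Finset.sum_le_sum fun i _ => ?_
    have := (div_le_iff₀ (pow_pos (hσ i) 2)).1 (h i).2
    nlinarith [mul_le_mul_of_nonneg_left this (sq_nonneg (Q j i))]

/-! ### The stacked estimator, its covariance and its shift equivariance. -/

section

variable {n p : ℕ} (Ψ : Matrix (Fin p) (Fin n) ℝ) (σ : Fin n → ℝ) (w : ℕ → Fin n → ℝ)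

/-- The stacked matrix of `D_1, …, D_k`. -/
noncomputable def stackedEstMat (k : ℕ) : Matrix (Fin k × Fin p) (Fin n) ℝ :=
  Matrix.of fun a i => estMat Ψ σ w (a.1 + 1) a.2 i

/-- All windows see the same noise: `J_k ⊗ Σ` is the covariance of `k` copies of one noise vector,
so the block form collapses to that of a single linear map of the data. -/
theorem jointCov_eq (k : ℕ) :
    jointCov Ψ σ w k =
      stackedEstMat Ψ σ w k * diagonal (fun i => σ i ^ 2) * (stackedEstMat Ψ σ w k)ᵀ := by
  have h : blockEstMat Ψ σ w k * ((Matrix.of fun _ _ => 1 : Matrix (Fin k) (Fin k) ℝ) ⊗ₖ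
      diagonal fun i => σ i ^ 2) =
      Matrix.of fun a b => (stackedEstMat Ψ σ w k * diagonal (fun i => σ i ^ 2)) a b.2 := by
    ext a b
    rw [Matrix.mul_apply, Fintype.sum_prod_type, Finset.sum_eq_single a.1]
    · simp [blockEstMat, stackedEstMat, kroneckerMap_apply, diagonal_apply, Matrix.mul_apply]
    · intro c _ hc
      exact Finset.sum_eq_zero fun i _ => by simp [blockEstMat, Ne.symm hc]
    · simp
  rw [jointCov, h]
  ext a b
  rw [Matrix.mul_apply, Fintype.sum_prod_type, Finset.sum_eq_single b.1, Matrix.mul_apply]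
  · refine Finset.sum_congr rfl fun i _ => ?_
    simp only [of_apply, transpose_apply, blockEstMat, stackedEstMat, if_true]
  · intro c _ hc
    exact Finset.sum_eq_zero fun i _ => by simp [blockEstMat, Ne.symm hc]
  · simp

theorem jointCov_posDef_of_le {k K : ℕ} (hk : k ≤ K) (h : (jointCov Ψ σ w K).PosDef) :
    (jointCov Ψ σ w k).PosDef := by
  have e : jointCov Ψ σ w k = (jointCov Ψ σ w K).submatrix
      (Prod.map (Fin.castLE hk) id) (Prod.map (Fin.castLE hk) id) := by
    rw [jointCov_eq, jointCov_eq]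
    rfl
  rw [e]
  exact h.submatrix ((Fin.castLE_injective hk).prodMap Function.injective_id)

theorem stackedEstMat_mulVec (k : ℕ) (y : Fin n → ℝ) (a : Fin k × Fin p) :
    (stackedEstMat Ψ σ w k *ᵥ y) a = qmle Ψ σ w y (a.1 + 1) a.2 := rfl

variable {Ψ σ w}

theorem estMat_mul_transpose {k : ℕ} (hB : IsUnit (infoMat Ψ σ w k).det) :
    estMat Ψ σ w k * Ψᵀ = 1 := by
  rw [estMat, Matrix.mul_assoc, Matrix.mul_assoc, ← Matrix.mul_assoc Ψ]
  exact nonsing_inv_mul _ hB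

/-- Since `D_k Ψᵀ = I`, a parametric signal is reproduced exactly, with the same `θ` in every
window. -/
theorem qmle_sub_design {k : ℕ} (hB : IsUnit (infoMat Ψ σ w k).det) (y : Fin n → ℝ)
    (θ : Fin p → ℝ) : qmle Ψ σ w (y - Ψᵀ *ᵥ θ) k = qmle Ψ σ w y k - θ := by
  rw [qmle, mulVec_sub, mulVec_mulVec, estMat_mul_transpose hB, one_mulVec, qmle]

/-- Identifies the bias vector as the mean of the stacked estimates once the signal `Ψᵀ θ` is
removed from the data. -/
theorem stackedEstMat_mulVec_sub_design {k : ℕ}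
    (hB : ∀ l, 1 ≤ l → l ≤ k → IsUnit (infoMat Ψ σ w l).det) (f : Fin n → ℝ) (θ : Fin p → ℝ) :
    stackedEstMat Ψ σ w k *ᵥ (f - Ψᵀ *ᵥ θ) = biasVec Ψ σ w f θ k := by
  funext a
  rw [stackedEstMat_mulVec, qmle_sub_design (hB _ (by omega) (by have := a.1.2; omega))]
  rfl

theorem infoMat_posSemidef {k : ℕ} (hw : ∀ i, 0 ≤ w k i) : (infoMat Ψ σ w k).PosSemidef := by
  have h : (weightMat σ w k).PosSemidef :=
    PosSemidef.diagonal fun i => div_nonneg (hw i) (sq_nonneg _)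
  have := h.mul_mul_conjTranspose_same Ψ
  rwa [conjTranspose_eq_transpose_of_trivial] at this

theorem quadDist_nonneg {k : ℕ} (hw : ∀ i, 0 ≤ w k i) (a b : Fin p → ℝ) :
    0 ≤ quadDist Ψ σ w k a b := by
  have := (infoMat_posSemidef (Ψ := Ψ) (σ := σ) hw).dotProduct_mulVec_nonneg (a - b)
  rwa [star_trivial] at this

/-! ### The selection rule and its invariance. -/

variable {K : ℕ} {z : ℕ → ℝ}

/-- The window `k` is accepted. -/
def Accepted (Ψ : Matrix (Fin p) (Fin n) ℝ) (σ : Fin n → ℝ) (w : ℕ → Fin n → ℝ)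
    (z : ℕ → ℝ) (y : Fin n → ℝ) (k : ℕ) : Prop :=
  ∀ l m : ℕ, 1 ≤ l → l < m → m ≤ k → fllStat Ψ σ w y l m ≤ z l

open Classical in
theorem adaptIndex_eq_findGreatest (y : Fin n → ℝ) :
    adaptIndex Ψ σ w K z y = Nat.findGreatest (Accepted Ψ σ w z y) K := rfl

theorem accepted_of_le_adaptIndex {y : Fin n → ℝ} {k : ℕ}
    (h : k ≤ adaptIndex Ψ σ w K z y) : Accepted Ψ σ w z y k := by
  classical
  -- Window `0` is vacuously accepted, so the default value of `Nat.findGreatest` does no harm.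
  have h0 : Accepted Ψ σ w z y 0 := fun l m _ h2 h3 => by omega
  rw [adaptIndex_eq_findGreatest] at h
  exact fun l m h1 h2 h3 => Nat.findGreatest_spec (Nat.zero_le K) h0 l m h1 h2 (h3.trans h)

theorem le_adaptIndex {y : Fin n → ℝ} {k : ℕ} (hk : k ≤ K) (h : Accepted Ψ σ w z y k) :
    k ≤ adaptIndex Ψ σ w K z y := by
  classical
  rw [adaptIndex_eq_findGreatest]
  exact Nat.le_findGreatest hk h

theorem one_le_adaptIndex (hK : 1 ≤ K) (y : Fin n → ℝ) : 1 ≤ adaptIndex Ψ σ w K z y :=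
  le_adaptIndex hK fun l m _ h2 h3 => by omega

/-- The fitted log-likelihoods depend on the data only through the estimates up to a common
shift. -/
theorem accepted_congr {k : ℕ} (hB : ∀ l, 1 ≤ l → l ≤ k → IsUnit (infoMat Ψ σ w l).det)
    {y y' : Fin n → ℝ} {θ : Fin p → ℝ}
    (h : ∀ l, 1 ≤ l → l ≤ k → qmle Ψ σ w y' l = qmle Ψ σ w y l - θ) {j : ℕ} (hj : j ≤ k) :
    Accepted Ψ σ w z y' j ↔ Accepted Ψ σ w z y j := by
  refine forall₅_congr fun l m h1 h2 h3 => ?_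
  rw [fllStat, fllStat, two_mul_logLik_sub _ _ _ _ _ (hB l h1 (by omega)),
    two_mul_logLik_sub _ _ _ _ _ (hB l h1 (by omega)), h l h1 (by omega), h m (by omega) (by omega),
    quadDist, quadDist, sub_sub_sub_cancel_right]

/-- The index `k̂` itself may depend on windows beyond `k`. Its truncation does not: for `j ≤ k`, `j
≤ k̂` means that `j` is accepted, which involves windows up to `j` only. -/
theorem min_adaptIndex_congr {k : ℕ} (hk : k ≤ K)
    (hB : ∀ l, 1 ≤ l → l ≤ k → IsUnit (infoMat Ψ σ w l).det)
    {y y' : Fin n → ℝ} {θ : Fin p → ℝ}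
    (h : ∀ l, 1 ≤ l → l ≤ k → qmle Ψ σ w y' l = qmle Ψ σ w y l - θ) :
    min k (adaptIndex Ψ σ w K z y') = min k (adaptIndex Ψ σ w K z y) := by
  refine eq_of_forall_le_iff fun j => ?_
  rw [le_min_iff, le_min_iff]
  refine and_congr_right fun hj => ?_
  have e : ∀ x : Fin n → ℝ, j ≤ adaptIndex Ψ σ w K z x ↔ Accepted Ψ σ w z x j :=
    fun x => ⟨accepted_of_le_adaptIndex, le_adaptIndex (hj.trans hk)⟩
  rw [e, e, accepted_congr hB h hj]

/-- The loss `(θ̃_k - θ̂_k)ᵀ B_k (θ̃_k - θ̂_k)` of the last accepted estimate. -/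
noncomputable def acceptedLoss (Ψ : Matrix (Fin p) (Fin n) ℝ) (σ : Fin n → ℝ) (w : ℕ → Fin n → ℝ)
    (K : ℕ) (z : ℕ → ℝ) (k : ℕ) (y : Fin n → ℝ) : ℝ :=
  quadDist Ψ σ w k (qmle Ψ σ w y k) (lastAccepted Ψ σ w K z k y)

theorem acceptedLoss_congr {k : ℕ} (h1 : 1 ≤ k) (hk : k ≤ K)
    (hB : ∀ l, 1 ≤ l → l ≤ k → IsUnit (infoMat Ψ σ w l).det)
    {y y' : Fin n → ℝ} {θ : Fin p → ℝ}
    (h : ∀ l, 1 ≤ l → l ≤ k → qmle Ψ σ w y' l = qmle Ψ σ w y l - θ) :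
    acceptedLoss Ψ σ w K z k y' = acceptedLoss Ψ σ w K z k y := by
  rw [acceptedLoss, acceptedLoss, lastAccepted, lastAccepted, min_adaptIndex_congr hk hB h,
    h k h1 le_rfl, h _ (le_min h1 (one_le_adaptIndex (h1.trans hk) y)) (min_le_left _ _),
    quadDist, quadDist, sub_sub_sub_cancel_right]

/-! ### Measurability of the adaptive procedure. -/

theorem measurable_qmle (k : ℕ) : Measurable fun y => qmle Ψ σ w y k := by
  unfold qmle
  have : Continuous fun y => estMat Ψ σ w k *ᵥ y := by fun_prop
  exact this.measurable

theorem measurable_quadDist (k : ℕ) {α : Type*} [MeasurableSpace α] {a b : α → Fin p → ℝ}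
    (ha : Measurable a) (hb : Measurable b) : Measurable fun x => quadDist Ψ σ w k (a x) (b x) := by
  have : Continuous fun v : Fin p → ℝ => v ⬝ᵥ (infoMat Ψ σ w k *ᵥ v) := by fun_prop
  exact this.measurable.comp (ha.sub hb)

theorem measurable_fllStat (l m : ℕ) : Measurable fun y => fllStat Ψ σ w y l m := by
  have hL : Continuous fun x : (Fin n → ℝ) × (Fin p → ℝ) => logLik Ψ σ w x.1 l x.2 := by
    unfold logLik
    fun_prop
  exact ((hL.measurable.comp (measurable_id.prodMk (measurable_qmle l))).sub
    (hL.measurable.comp (measurable_id.prodMk (measurable_qmle m)))).const_mul 2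

theorem measurable_adaptIndex : Measurable (adaptIndex Ψ σ w K z) := by
  classical
  refine measurable_findGreatest fun k _ => ?_
  simp only [Set.ofPred_forall]
  refine MeasurableSet.iInter fun l => MeasurableSet.iInter fun m => MeasurableSet.iInter fun _ =>
    MeasurableSet.iInter fun _ => MeasurableSet.iInter fun _ => ?_
  exact measurableSet_le (measurable_fllStat l m) measurable_const

theorem measurable_lastAccepted (k : ℕ) : Measurable (lastAccepted Ψ σ w K z k) := by
  have h : Measurable fun x : ℕ × (Fin n → ℝ) => qmle Ψ σ w x.2 x.1 :=
    -- The window is random, so measurability is needed jointly in window and data; there are only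
    -- countably many windows.
    measurable_from_prod_countable_right fun j => measurable_qmle j
  have hm : Measurable fun y => min k (adaptIndex Ψ σ w K z y) :=
    (measurable_of_countable fun j => min k j).comp measurable_adaptIndex
  have := h.comp (hm.prodMk measurable_id)
  exact this

theorem measurable_acceptedLoss (k : ℕ) : Measurable (acceptedLoss Ψ σ w K z k) :=
  measurable_quadDist k (measurable_qmle k) (measurable_lastAccepted k)

/-- Either the oracle estimate is rejected and its loss is that of the last accepted estimate, or
it is accepted and its loss is bounded by the critical value. -/
theorem quadDist_adaptEst_rpow_le {k : ℕ} (h1 : 1 ≤ k) (hw : ∀ i, 0 ≤ w k i)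
    (hB : IsUnit (infoMat Ψ σ w k).det) (hz : 0 ≤ z k) {s : ℝ} (hs : 0 ≤ s) (y : Fin n → ℝ) :
    |quadDist Ψ σ w k (qmle Ψ σ w y k) (adaptEst Ψ σ w K z y)| ^ s ≤
      z k ^ s + |acceptedLoss Ψ σ w K z k y| ^ s := by
  rcases le_or_gt (adaptIndex Ψ σ w K z y) k with h | h
  · rw [adaptEst, acceptedLoss, lastAccepted, min_eq_right h]
    exact le_add_of_nonneg_left (Real.rpow_nonneg hz s)
  · refine le_add_of_le_of_nonneg ?_ (Real.rpow_nonneg (abs_nonneg _) s)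
    rw [abs_of_nonneg (quadDist_nonneg hw _ _)]
    refine Real.rpow_le_rpow (quadDist_nonneg hw _ _) ?_ hs
    have := accepted_of_le_adaptIndex (le_refl (adaptIndex Ψ σ w K z y)) k _ h1 h le_rfl
    rwa [fllStat, two_mul_logLik_sub _ _ _ _ _ hB] at this

end

/-! ### Explicit bounds in `δ`. -/

/-- The second moment of the likelihood ratio is bounded through the bounds on the variances. -/
theorem sqrt_prod_ratio_moment_le {ι : Type*} [Fintype ι] {δ : ℝ} (hδ0 : 0 ≤ δ) (hδ1 : δ < 1)
    {lam β : ι → ℝ} (h : ∀ j, 1 - δ ≤ lam j ∧ lam j ≤ 1 + δ) :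
    (∏ j, ((√(lam j * (2 - lam j)))⁻¹ * Real.exp (β j ^ 2 / (2 - lam j)))) ^ (1 / 2 : ℝ) ≤
      (1 + δ) ^ ((Fintype.card ι : ℝ) / 4) * (1 - δ) ^ (-(3 * (Fintype.card ι : ℝ) / 4)) *
        Real.exp ((∑ j, β j ^ 2) / (2 * (1 - δ))) := by
  have d1 : 0 < 1 - δ := by linarith
  have d2 : 0 < 1 + δ := by linarith
  have hf : ∀ j, (√(lam j * (2 - lam j)))⁻¹ * Real.exp (β j ^ 2 / (2 - lam j)) ≤
      (1 + δ) ^ (1 / 2 : ℝ) * (1 - δ) ^ (-(3 / 2) : ℝ) * Real.exp (β j ^ 2 / (1 - δ)) := by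
    intro j
    obtain ⟨l1, l2⟩ := h j
    have l3 : 1 - δ ≤ 2 - lam j := by linarith
    -- `λ (2 - λ) = 1 - (λ - 1)²`, and `|λ - 1| ≤ δ`.
    have hq : (1 - δ) * (1 + δ) ≤ lam j * (2 - lam j) := by nlinarith
    refine mul_le_mul ?_ (Real.exp_le_exp.2 (by gcongr)) (Real.exp_nonneg _) (by positivity)
    calc (√(lam j * (2 - lam j)))⁻¹ ≤ (√((1 + δ) * (1 - δ)))⁻¹ := by
          rw [mul_comm (1 + δ)]
          gcongr
      _ = (1 + δ) ^ (-(1 / 2) : ℝ) * (1 - δ) ^ (-(1 / 2) : ℝ) := by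
          rw [Real.sqrt_eq_rpow, ← Real.rpow_neg (by positivity), Real.mul_rpow d2.le d1.le]
      -- A deliberate loss: exponents `-1/2, -1/2` are relaxed to `1/2, -3/2`, the powers of the
      -- final bound.
      _ ≤ _ := mul_le_mul
          (Real.rpow_le_rpow_of_exponent_le (by linarith) (by norm_num))
          (Real.rpow_le_rpow_of_exponent_ge d1 (by linarith) (by norm_num))
          (by positivity) (by positivity)
  calc (∏ j, ((√(lam j * (2 - lam j)))⁻¹ * Real.exp (β j ^ 2 / (2 - lam j)))) ^ (1 / 2 : ℝ)
      ≤ (∏ j, ((1 + δ) ^ (1 / 2 : ℝ) * (1 - δ) ^ (-(3 / 2) : ℝ) *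
          Real.exp (β j ^ 2 / (1 - δ)))) ^ (1 / 2 : ℝ) :=
        Real.rpow_le_rpow (Finset.prod_nonneg fun j _ => by positivity)
          (Finset.prod_le_prod (fun j _ => by positivity) fun j _ => hf j) (by norm_num)
    _ = _ := by
        rw [Finset.prod_mul_distrib, Finset.prod_const, Finset.card_univ, ← Real.exp_sum, mul_pow,
          ← Real.rpow_natCast, ← Real.rpow_natCast, Real.mul_rpow (by positivity) (by positivity),
          Real.mul_rpow (by positivity) (by positivity), ← Real.rpow_mul d2.le,
          ← Real.rpow_mul d2.le, ← Real.rpow_mul d1.le, ← Real.rpow_mul d1.le, ← Real.exp_mul,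
          ← Finset.sum_div]
        have t1 : (1 / 2 : ℝ) * (Fintype.card ι : ℝ) * (1 / 2) = (Fintype.card ι : ℝ) / 4 := by
          ring
        have t2 : -(3 / 2 : ℝ) * (Fintype.card ι : ℝ) * (1 / 2) =
            -(3 * (Fintype.card ι : ℝ) / 4) := by ring
        have t3 : (∑ j, β j ^ 2) / (1 - δ) * (1 / 2) = (∑ j, β j ^ 2) / (2 * (1 - δ)) := by
          field_simp
        rw [t1, t2, t3]

/-- The argument yields the exponent `Δ / (2 (1 - δ))` without distinguishing the error structure;
the factor `φ(δ)` only enlarges it. -/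
theorem one_le_noiseFactor {n : ℕ} (σ₀ σ : Fin n → ℝ) {δ : ℝ} (hδ0 : 0 ≤ δ) (hδ1 : δ < 1) :
    1 ≤ noiseFactor σ₀ σ δ := by
  rw [noiseFactor]
  split_ifs
  · exact le_rfl
  · have : 2 ≤ 2 * (1 + δ) / (1 - δ) ^ 2 := by
      rw [le_div_iff₀ (by nlinarith)]
      nlinarith
    linarith

/-! ### Change of measure for the accepted loss. -/

section

variable {n p K : ℕ} {Ψ : Matrix (Fin p) (Fin n) ℝ} {σ σ₀ : Fin n → ℝ} {w : ℕ → Fin n → ℝ}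
  {f : Fin n → ℝ} {z : ℕ → ℝ} {θ : Fin p → ℝ} {δ : ℝ} {k : ℕ}

/-- The law of the accepted loss does not change if a parametric signal is subtracted. -/
theorem lintegral_acceptedLoss_sub_design (h1 : 1 ≤ k) (hk : k ≤ K)
    (hB : ∀ l, 1 ≤ l → l ≤ k → IsUnit (infoMat Ψ σ w l).det) (f : Fin n → ℝ) (θ : Fin p → ℝ)
    {g : ℝ → ℝ≥0∞} (hg : Measurable g) :
    ∫⁻ y, g (acceptedLoss Ψ σ w K z k y) ∂(obsLaw f σ₀) =
      ∫⁻ y, g (acceptedLoss Ψ σ w K z k y) ∂(obsLaw (f - Ψᵀ *ᵥ θ) σ₀) := by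
  have hm := hg.comp (measurable_acceptedLoss (Ψ := Ψ) (σ := σ) (w := w) (K := K) (z := z) k)
  have hm' : Measurable fun y => g (acceptedLoss Ψ σ w K z k y) := hm
  rw [obsLaw, obsLaw, lintegral_map hm' (by fun_prop), lintegral_map hm' (by fun_prop)]
  refine lintegral_congr fun ε => congrArg g (acceptedLoss_congr h1 hk hB (θ := θ) ?_).symm
  intro l hl1 hl2
  rw [← qmle_sub_design (hB l hl1 hl2)]
  congr 1
  funext i
  simp only [Pi.sub_apply]
  ring

/-- The loss of the last accepted estimate under the true law, in terms of its second moment under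
the approximate model and the modeling bias. -/
theorem lintegral_acceptedLoss_le (h1 : 1 ≤ k) (hk : k ≤ K)
    (hB : ∀ l, 1 ≤ l → l ≤ k → IsUnit (infoMat Ψ σ w l).det)
    (hcov : (jointCov Ψ σ w k).PosDef) (hσ : ∀ i, 0 < σ i) (hδ0 : 0 ≤ δ) (hδ1 : δ < 1)
    (hA4 : ∀ i, 1 - δ ≤ σ₀ i ^ 2 / σ i ^ 2 ∧ σ₀ i ^ 2 / σ i ^ 2 ≤ 1 + δ)
    {g : ℝ → ℝ≥0∞} (hg : Measurable g) :
    ∫⁻ y, g (acceptedLoss Ψ σ w K z k y) ∂(obsLaw f σ₀) ≤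
      (∫⁻ y, g (acceptedLoss Ψ σ w K z k y) ^ (2 : ℝ) ∂(obsLaw 0 σ)) ^ (1 / 2 : ℝ) *
        ENNReal.ofReal ((1 + δ) ^ ((p : ℝ) * k / 4) * (1 - δ) ^ (-(3 * (p : ℝ) * k / 4)) *
          Real.exp (modelBias Ψ σ w f θ k / (2 * (1 - δ)))) := by
  set D := stackedEstMat Ψ σ w k with hD
  obtain ⟨R, lam, hR1, hR2, hR3⟩ := exists_simultaneous_diagonalization hcov
    (T := D * diagonal (fun i => σ₀ i ^ 2) * Dᵀ) (by
      rw [IsHermitian, conjTranspose_eq_transpose_of_trivial]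
      simp only [transpose_mul, transpose_transpose, diagonal_transpose, Matrix.mul_assoc])
  rw [jointCov_eq, ← hD] at hR1
  set Q := R * D with hQ
  have hQ1 : Q * diagonal (fun i => σ i ^ 2) * Qᵀ = 1 := by
    rw [hQ, transpose_mul, ← hR1]; simp only [Matrix.mul_assoc]
  have hQ2 : Q * diagonal (fun i => σ₀ i ^ 2) * Qᵀ = diagonal lam := by
    rw [hQ, transpose_mul, ← hR2]; simp only [Matrix.mul_assoc]
  have hlam := diagonalized_variance_bounds hσ hA4 hQ1 hQ2
  have hlam0 : ∀ j, 0 < lam j := fun j => by linarith [(hlam j).1]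
  set v : Fin k × Fin p → ℝ≥0 := fun j => .mk (lam j) (hlam0 j).le with hv
  have hvlam : ∀ j, (v j : ℝ) = lam j := fun j => rfl
  -- `V = Σ Qᵀ` is a right inverse of `Q`. As `R` is square, `R (D V) = 1` also gives `D V R = 1`,
  -- so `D V Q = D`: the estimates, and with them the loss, can be recovered from `Q y`.
  set V := diagonal (fun i => σ i ^ 2) * Qᵀ with hV
  have hDVQ : ∀ y, D *ᵥ (V *ᵥ (Q *ᵥ y)) = D *ᵥ y := by
    have hDV : D * V * R = 1 := by
      rw [mul_eq_one_comm, ← hQ1, hV, hQ]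
      simp only [Matrix.mul_assoc]
    intro y
    rw [mulVec_mulVec, mulVec_mulVec, hQ, ← Matrix.mul_assoc, hDV, Matrix.one_mul]
  have hloss : ∀ y, acceptedLoss Ψ σ w K z k (V *ᵥ (Q *ᵥ y)) = acceptedLoss Ψ σ w K z k y := by
    intro y
    refine acceptedLoss_congr h1 hk hB (θ := 0) fun l hl1 hl2 => ?_
    funext a
    -- Block `l - 1` of the stacked vector belongs to window `l`.
    have := congrFun (hDVQ y) (⟨l - 1, by omega⟩, a)
    rw [hD, stackedEstMat_mulVec, stackedEstMat_mulVec] at this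
    simpa only [Nat.sub_add_cancel hl1, sub_zero] using this
  have hcont : ∀ {m m' : Type} [Fintype m] [Fintype m'] (M : Matrix m m' ℝ),
      Measurable fun x => M *ᵥ x := fun M => by
    have : Continuous fun x => M *ᵥ x := by fun_prop
    exact this.measurable
  set G : (Fin k × Fin p → ℝ) → ℝ≥0∞ := fun x => g (acceptedLoss Ψ σ w K z k (V *ᵥ x)) with hG
  have hGm : Measurable G := hg.comp ((measurable_acceptedLoss k).comp (hcont V))
  have htrue : ∫⁻ y, g (acceptedLoss Ψ σ w K z k y) ∂(obsLaw f σ₀) =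
      ∫⁻ x, G x ∂(Measure.pi fun j => gaussianReal ((Q *ᵥ (f - Ψᵀ *ᵥ θ)) j) (v j)) := by
    rw [lintegral_acceptedLoss_sub_design h1 hk hB f θ hg,
      ← obsLaw_map_mulVec (f - Ψᵀ *ᵥ θ) σ₀ Q v hQ2, lintegral_map hGm (hcont Q)]
    exact lintegral_congr fun y => congrArg g (hloss y).symm
  have hmodel : ∫⁻ y, g (acceptedLoss Ψ σ w K z k y) ^ (2 : ℝ) ∂(obsLaw 0 σ) =
      ∫⁻ x, G x ^ (2 : ℝ) ∂(Measure.pi fun _ => gaussianReal 0 1) := by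
    have := obsLaw_map_mulVec 0 σ Q (fun _ => 1) (by rw [hQ1]; simp)
    simp only [mulVec_zero, Pi.zero_apply] at this
    rw [← this, lintegral_map (hGm.pow_const _) (hcont Q)]
    exact lintegral_congr fun y => congrArg (fun t => g t ^ (2 : ℝ)) (hloss y).symm
  -- The sum is `‖R b(k)‖²`, and `Rᵀ R` is the inverse joint covariance.
  have hbias : ∑ j, (Q *ᵥ (f - Ψᵀ *ᵥ θ)) j ^ 2 = modelBias Ψ σ w f θ k := by
    rw [hQ, ← mulVec_mulVec, hD, stackedEstMat_mulVec_sub_design hB, modelBias, ← hR3,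
      ← mulVec_mulVec, dotProduct_mulVec, vecMul_transpose]
    exact Finset.sum_congr rfl fun j _ => sq _
  have hcard : (Fintype.card (Fin k × Fin p) : ℝ) = p * k := by
    rw [Fintype.card_prod, Fintype.card_fin, Fintype.card_fin]
    push_cast
    ring
  rw [htrue, hmodel]
  refine (lintegral_pi_gaussian_le _ v (fun j h => ?_) (fun j => ?_) hGm).trans ?_
  · exact (hlam0 j).ne' (by rw [← hvlam, h, NNReal.coe_zero])
  · rw [hvlam]; linarith [(hlam j).2]
  · gcongr
    rw [ENNReal.ofReal_rpow_of_nonneg (Finset.prod_nonneg fun j _ => by positivity) (by norm_num)]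
    refine ENNReal.ofReal_le_ofReal ?_
    simp only [hvlam]
    refine (sqrt_prod_ratio_moment_le hδ0 hδ1 hlam).trans (le_of_eq ?_)
    rw [hcard, hbias, ← mul_assoc 3 (p : ℝ)]

end

end

/-! ### The oracle inequality. -/

theorem theorem3 {n p K : ℕ} (hK : 1 ≤ K)
    -- design matrix, model and true standard deviations, localizing weights, mean vector
    (Ψ : Matrix (Fin p) (Fin n) ℝ) (σ σ₀ : Fin n → ℝ) (w : ℕ → Fin n → ℝ) (f : Fin n → ℝ)
    (hσ : ∀ i, 0 < σ i) (hσ₀ : ∀ i, 0 ≤ σ₀ i)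
    (hw : ∀ k, 1 ≤ k → k ≤ K → ∀ i, 0 ≤ w k i ∧ w k i ≤ 1)
    -- standing non-degeneracy assumptions
    (hB : ∀ k, 1 ≤ k → k ≤ K → 0 < (infoMat Ψ σ w k).det)
    (hcov : (jointCov Ψ σ w K).PosDef)
    -- full row rank of the design matrix
    (hA1 : Ψ.rank = p)
    -- at least `p` design points in the smallest window
    (hA2 : p ≤ (Finset.univ.filter fun i => 0 < w 1 i).card)
    -- nested windows
    (hA3 : ∀ k l, 1 ≤ k → k ≤ l → l ≤ K → ∀ i, w k i ≤ w l i)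
    -- relative variability in errors
    (δ : ℝ) (hδ0 : 0 ≤ δ) (hδ1 : δ < 1)
    (hA4 : ∀ i, 1 - δ ≤ σ₀ i ^ 2 / σ i ^ 2 ∧ σ₀ i ^ 2 / σ i ^ 2 ≤ 1 + δ)
    -- geometric growth
    (hA5 : GeometricGrowth Ψ σ w K)
    -- critical values satisfying the propagation conditions
    (r α : ℝ) (hr : 0 < r) (hα0 : 0 < α) (hα1 : α ≤ 1)
    (z : ℕ → ℝ) (hz : ∀ k, 1 ≤ k → k ≤ K → 0 ≤ z k)
    (hPC : PropagationConditions Ψ σ w K z r α)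
    -- small modeling bias at the first step
    (θ : Fin p → ℝ) (Δ : ℝ) (hΔ : modelBias Ψ σ w f θ 1 ≤ Δ)
    (kstar : ℕ) (hkstar : kstar = oracleIndex Ψ σ w f θ K Δ) :
    ∫⁻ y, ENNReal.ofReal
        (|quadDist Ψ σ w kstar (qmle Ψ σ w y kstar) (adaptEst Ψ σ w K z y)| ^ (r / 2))
        ∂(obsLaw f σ₀)
      ≤ ENNReal.ofReal
        (z kstar ^ (r / 2) +
          (α * chiSqMoment p r) ^ (1 / 2 : ℝ) *
            (1 + δ) ^ ((p : ℝ) * kstar / 4) * (1 - δ) ^ (-(3 * (p : ℝ) * kstar / 4)) *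
            Real.exp (noiseFactor σ₀ σ δ * (Δ / (2 * (1 - δ))))) := by
  classical
  have hk1 : 1 ≤ kstar := by
    rw [hkstar, oracleIndex]
    exact Nat.le_findGreatest hK hΔ
  have hkK : kstar ≤ K := by
    rw [hkstar, oracleIndex]
    exact Nat.findGreatest_le K
  have hΔk : modelBias Ψ σ w f θ kstar ≤ Δ := by
    rw [hkstar, oracleIndex]
    exact Nat.findGreatest_spec (P := fun k => modelBias Ψ σ w f θ k ≤ Δ) hK hΔ
  clear hkstar
  have hu : ∀ l, 1 ≤ l → l ≤ kstar → IsUnit (infoMat Ψ σ w l).det :=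
    fun l h1 h2 => isUnit_iff_ne_zero.2 (hB l h1 (h2.trans hkK)).ne'
  have hcovk := jointCov_posDef_of_le Ψ σ w hkK hcov
  have hΔ0 : 0 ≤ Δ := by
    have := hcovk.inv.posSemidef.dotProduct_mulVec_nonneg (biasVec Ψ σ w f θ kstar)
    rw [star_trivial] at this
    exact le_trans this hΔk
  have hchi : 0 ≤ chiSqMoment p r :=
    integral_nonneg fun ξ => Real.rpow_nonneg (abs_nonneg _) r
  have d1 : 0 < 1 - δ := by linarith
  have d2 : 0 < 1 + δ := by linarith
  set g : ℝ → ℝ≥0∞ := fun t => ENNReal.ofReal (|t| ^ (r / 2)) with hg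
  have hgm : Measurable g :=
    ((measurable_id.abs : Measurable fun t : ℝ => |t|).pow_const _).ennreal_ofReal
  have hsq : ∀ t, g t ^ (2 : ℝ) = ENNReal.ofReal (|t| ^ r) := by
    intro t
    rw [hg, ENNReal.ofReal_rpow_of_nonneg (Real.rpow_nonneg (abs_nonneg t) _) zero_le_two,
      ← Real.rpow_mul (abs_nonneg t), div_mul_cancel₀ _ two_ne_zero]
  have hprop : ∫⁻ y, g (acceptedLoss Ψ σ w K z kstar y) ^ (2 : ℝ) ∂(obsLaw 0 σ) ≤
      ENNReal.ofReal (α * chiSqMoment p r) := by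
    simp only [hsq]
    -- The propagation conditions start at window `2`. For `k* = 1` the loss vanishes because `k̂ ≥
    -- 1`.
    rcases hk1.eq_or_lt with h | h
    · have h0 : ∀ y, acceptedLoss Ψ σ w K z kstar y = 0 := by
        intro y
        rw [← h, acceptedLoss, lastAccepted, min_eq_left (one_le_adaptIndex hK y), quadDist,
          sub_self, zero_dotProduct]
      simp [h0, Real.zero_rpow hr.ne']
    · exact hPC kstar h hkK
  have hmain := (lintegral_acceptedLoss_le (f := f) (z := z) (θ := θ) hk1 hkK hu hcovk hσ hδ0 hδ1
    hA4 hgm).trans (mul_le_mul_left (ENNReal.rpow_le_rpow hprop (by norm_num)) _)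
  have hz0 := Real.rpow_nonneg (hz kstar hk1 hkK) (r / 2)
  calc _ ≤ ∫⁻ y, (ENNReal.ofReal (z kstar ^ (r / 2)) + g (acceptedLoss Ψ σ w K z kstar y))
        ∂(obsLaw f σ₀) := by
        refine lintegral_mono fun y => ?_
        rw [hg, ← ENNReal.ofReal_add hz0 (Real.rpow_nonneg (abs_nonneg _) _)]
        exact ENNReal.ofReal_le_ofReal (quadDist_adaptEst_rpow_le hk1
          (fun i => (hw kstar hk1 hkK i).1) (hu kstar hk1 le_rfl) (hz kstar hk1 hkK) (by positivity) y)
    _ = ENNReal.ofReal (z kstar ^ (r / 2)) +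
        ∫⁻ y, g (acceptedLoss Ψ σ w K z kstar y) ∂(obsLaw f σ₀) := by
        rw [lintegral_add_left measurable_const, lintegral_const, measure_univ, mul_one]
    _ ≤ _ := by
        rw [ENNReal.ofReal_add hz0 (by positivity)]
        gcongr
        refine hmain.trans ?_
        rw [ENNReal.ofReal_rpow_of_nonneg (by positivity) (by norm_num),
          ← ENNReal.ofReal_mul (by positivity), ← mul_assoc, ← mul_assoc]
        refine ENNReal.ofReal_le_ofReal ?_
        gcongr
        rw [← mul_div_assoc]
        gcongr
        -- Uses `Δ(k*) ≤ Δ ≤ φ(δ) Δ`, where the second inequality needs `Δ ≥ 0`.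
        nlinarith [one_le_noiseFactor σ₀ σ hδ0 hδ1]
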